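/- **Theorem 3.1.** For $n\ge 1$ let $\mathbf P=(p_{ij})$ and $\mathbf S=(s_{ij})$ be symmetric $n\times n$ matrices with entries in $[0,1]$ and zero diagonal. The signed inhomogeneous Erdős–Rényi model $\mathsf G_n(\mathbf P,\mathbf S)$ is the law of the random symmetric matrix $A=(a_{ij})$ with $a_{ii}=0$ and $a_{ij}=a_{ji}=P_{ij}(1-2S_{ij})$ for $i<j$, where $P_{ij}\sim\mathrm{Bernoulli}(p_{ij})$ and $S_{ij}\sim\mathrm{Bernoulli}(s_{ij})$, $i<j$, are mutually independent. Let $\overline A=(\overline a_{ij})$, $\overline a_{ij}=p_{ij}(1-2s_{ij})$, be the mean signed adjacency matrix, and let $\|\cdot\|_{\mathrm{op}}$ denote the $\ell_2$-operator (spectral) norm. For all $r>0$, $c_0>0$ and $c_1>0$ there are a constant $C=C(r,c_0,c_1)>0$ and an integer $N=N(r,c_0,c_1)$ such that the following holds for every $n\ge N$, all $\mathbf P,\mathbf S$ as above, and every real $\alpha\ge c_1\log n$. If $A\sim\mathsf G_n(\mathbf P,\mathbf S)$, $$\min_{i,j}\left|s_{ij}-\tfrac12\right|>c_0\qquad\text{and}\qquad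 n\max_{i,j}|\overline a_{ij}|\le\alpha,$$ then $$\mathbb P\left(\|A-\overline A\|_{\mathrm{op}}\le C\sqrt{\alpha}\right)\ \ge\ 1-n^{-r}.$$ -/

import Mathlib

open MeasureTheory ProbabilityTheory

noncomputable section

/-- Real matrices carry the product (entrywise Borel) σ-algebra. -/
instance instMeasurableSpaceRealMatrix (n : ℕ) : MeasurableSpace (Matrix (Fin n) (Fin n) ℝ) :=
  inferInstanceAs (MeasurableSpace (Fin n → Fin n → ℝ))

/-- A symmetric `n × n` matrix of probabilities with zero diagonal. -/
structure ProbMatrix (n : ℕ) where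
  /-- The entries, as elements of the unit interval. -/
  prob : Fin n → Fin n → unitInterval
  symm : ∀ i j, prob i j = prob j i
  diag : ∀ i, prob i i = 0

/-- The real entry `p i j` of a matrix of probabilities. -/
def ProbMatrix.val {n : ℕ} (P : ProbMatrix n) (i j : Fin n) : ℝ := (P.prob i j : ℝ)

/-- The unordered pairs of distinct nodes `{i, j}`, listed with `i < j`. -/
abbrev NodePair (n : ℕ) : Type := {e : Fin n × Fin n // e.1 < e.2}

/-- The signed value of a pair of nodes. The first Boolean says whether the edge is present, the
second one whether the sign is negative. -/
def signedValue (b : Bool × Bool) : ℝ :=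
  if b.1 then (if b.2 then -1 else 1) else 0

/-- The symmetric signed adjacency matrix, with zero diagonal, of the signed graph in which `x e`
records presence and sign of the pair `e`. -/
def signedAdjacency {n : ℕ} (x : NodePair n → Bool × Bool) : Matrix (Fin n) (Fin n) ℝ :=
  Matrix.of fun i j =>
    if h : i < j then signedValue (x ⟨(i, j), h⟩)
    else if h : j < i then signedValue (x ⟨(j, i), h⟩)
    else 0

/-- Mutually independent edges and signs: the pair `{i, j}` is an edge with probability `p i j`,
and, independently, its sign is negative with probability `s i j`. -/
def edgeSignMeasure {n : ℕ} (P S : ProbMatrix n) : Measure (NodePair n → Bool × Bool) :=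
  Measure.pi fun e =>
    (bernoulliMeasure true false (P.prob e.1.1 e.1.2)).prod
      (bernoulliMeasure true false (S.prob e.1.1 e.1.2))

/-- The signed inhomogeneous Erdős–Rényi model `G_n(P, S)`, as the law of the signed adjacency
matrix. -/
def signedErdosRenyi {n : ℕ} (P S : ProbMatrix n) : Measure (Matrix (Fin n) (Fin n) ℝ) :=
  (edgeSignMeasure P S).map signedAdjacency

/-- The mean signed adjacency matrix, with entries `p i j * (1 - 2 * s i j)`. -/
def meanAdjacency {n : ℕ} (P S : ProbMatrix n) : Matrix (Fin n) (Fin n) ℝ :=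
  Matrix.of fun i j => P.val i j * (1 - 2 * S.val i j)

/-- The `ℓ²` operator norm (spectral norm) of a square real matrix. -/
def opNorm {n : ℕ} (M : Matrix (Fin n) (Fin n) ℝ) : ℝ :=
  ‖Matrix.toEuclideanCLM (n := Fin n) (𝕜 := ℝ) M‖

end

/-!
The proof is the moment method, with the combinatorial estimate obtained by comparison with a small
dense random matrix, in the manner of Bandeira and van Handel.

Let `X = A - E A`. The condition on the sign probabilities turns the bound on the mean entries into
a bound `q ≤ α / (2 c₀ n)` on the edge probabilities, so that the entries of `X` are centred, bounded
by `2`, and have variance at most `q`, where `n q` is of order `α`. For `k` of order `α`, chosen to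
be a power of two, `‖X‖ ^ (2k) ≤ tr X ^ (2k)`, and the trace is a sum over closed walks of length
`2k` on `n` vertices. A walk that uses some edge exactly once contributes zero in the mean, and any
other walk at most `4 ^ k q ^ e`, with `e` its number of distinct edges
(`abs_integral_walk_prod_le`).

A walk with `v` vertices has `v ≤ e + 1`. Grouping the walks by the equality pattern of their
vertices therefore shows that the sum of `q ^ e` over the walks on `n` vertices is at most `n` times
the *number* of walks on `R = 3k` vertices that use no edge exactly once (`sum_pow_card_edges_le`).

That number does not involve `n` or the model any more. It is at most the expected trace of
`Y ^ (2k)`, where `Y` is a symmetric `R × R` matrix of independent centred bounded variables with all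
higher moments at least `1` (`le_sum_prod_skewSign`). Because `R` and `k` are proportional, a net
argument and the subgaussian moments of the bilinear forms `⟨x, Y y⟩` bound it by `(walkRate * k) ^ k`
(`card_repeats_walk_le`): the net has exponential cardinality in `R`, that is, in `k`.

Altogether `E tr X ^ (2k) ≤ n (4 * walkRate * k) ^ k` (`integral_trace_pow_le`). By Markov's
inequality, `‖X‖ > C √α` has probability at most `n * exp (-k)`, and `k ≥ (r + 1) log n` makes this
at most `n ^ (-r)`.
-/

/-! ### Closed walks and traces of powers -/

/-- The `t`-th edge of the closed walk `u 0, u 1, …, u (m - 1), u 0`; the addition in `Fin m` is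
cyclic, so that the last edge leads back to `u 0`. -/
def walkEdge {m : ℕ} [NeZero m] {V : Type*} (u : Fin m → V) (t : Fin m) : Sym2 V :=
  s(u t, u (t + 1))

/-- No value of the labelling `p` is taken exactly once. -/
def Repeats {m : ℕ} {E : Type*} (p : Fin m → E) : Prop :=
  ∀ t, ∃ t', t' ≠ t ∧ p t' = p t

/-- Sums over all paths of length `m`, weighted by a function `h` of their endpoints, compute the
entries of `M ^ m`; the freedom in `h` is what the induction needs. -/
theorem sum_path_prod {V : Type*} [Fintype V] [DecidableEq V] (M : Matrix V V ℝ) (m : ℕ) :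
    ∀ h : V → V → ℝ,
      ∑ u : Fin (m + 1) → V, (∏ t : Fin m, M (u t.castSucc) (u t.succ)) * h (u 0) (u (Fin.last m)) =
        ∑ a, ∑ b, (M ^ m) a b * h a b := by
  induction m with
  | zero =>
    intro h
    rw [← (Equiv.funUnique (Fin 1) V).symm.sum_comp]
    simp [Matrix.one_apply]
  | succ m ih =>
    intro h
    rw [← (Fin.snocEquiv (fun _ : Fin (m + 2) => V)).sum_comp, Fintype.sum_prod_type,
      Finset.sum_comm]
    have key := ih (fun a b => ∑ c, M b c * h a c)
    calc _ = _ := ?_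
      _ = _ := key
      _ = _ := ?_
    · refine Finset.sum_congr rfl fun u _ => ?_
      rw [Finset.mul_sum]
      refine Finset.sum_congr rfl fun c _ => ?_
      rw [Fin.prod_univ_castSucc]
      have h0 : (Fin.snoc u c : Fin (m + 2) → V) 0 = u 0 := by
        rw [← Fin.castSucc_zero, Fin.snoc_castSucc]
      have h1 : ∀ t : Fin m, (Fin.snoc u c : Fin (m + 2) → V) t.castSucc.succ = u t.succ := by
        intro t
        rw [Fin.succ_castSucc, Fin.snoc_castSucc]
      simp only [Fin.snocEquiv_apply, Fin.snoc_castSucc, Fin.succ_last, Fin.snoc_last, h0, h1]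
      ring
    · refine Finset.sum_congr rfl fun a _ => ?_
      simp_rw [pow_succ, Matrix.mul_apply, Finset.sum_mul, Finset.mul_sum]
      rw [Finset.sum_comm]
      simp_rw [mul_assoc]

theorem trace_pow_eq_sum_closed_walk {V : Type*} [Fintype V] [DecidableEq V] (M : Matrix V V ℝ)
    (m : ℕ) [NeZero m] :
    (M ^ m).trace = ∑ u : Fin m → V, ∏ t, M (u t) (u (t + 1)) := by
  obtain ⟨m, rfl⟩ := Nat.exists_eq_succ_of_ne_zero (NeZero.ne m)
  have h := sum_path_prod M m (fun a b => M b a)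
  calc _ = ∑ a, ∑ b, (M ^ m) a b * M b a := by
        simp [Matrix.trace, pow_succ, Matrix.mul_apply]
    _ = _ := h.symm
    _ = _ := by
      refine Finset.sum_congr rfl fun u _ => ?_
      rw [Fin.prod_univ_castSucc]
      simp [Fin.coeSucc_eq_succ]

/-! ### Vertices and edges of a closed walk -/

/-- Each time a sequence of vertices reaches a new vertex, it does so along a new edge. -/
theorem card_image_range_succ_le {V : Type*} [DecidableEq V] (a : ℕ → V) (j : ℕ) :
    ((Finset.range (j + 1)).image a).card ≤
      ((Finset.range j).image fun i => s(a i, a (i + 1))).card + 1 := by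
  induction j with
  | zero => simp
  | succ j ih =>
    have hverts : (Finset.range (j + 1 + 1)).image a =
        insert (a (j + 1)) ((Finset.range (j + 1)).image a) := by
      rw [Finset.range_add_one, Finset.image_insert]
    have hedges : (Finset.range (j + 1)).image (fun i => s(a i, a (i + 1))) =
        insert s(a j, a (j + 1)) ((Finset.range j).image fun i => s(a i, a (i + 1))) := by
      rw [Finset.range_add_one, Finset.image_insert]
    rw [hverts, hedges]
    by_cases hv : a (j + 1) ∈ (Finset.range (j + 1)).image a
    · rw [Finset.insert_eq_of_mem hv]
      exact ih.trans (by gcongr; exact Finset.subset_insert _ _)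
    · -- a new vertex is reached along a new edge
      rw [Finset.card_insert_of_notMem hv, Finset.card_insert_of_notMem]
      · omega
      · intro hmem
        obtain ⟨i, hi, he⟩ := Finset.mem_image.1 hmem
        have hi' := Finset.mem_range.1 hi
        apply hv
        have : a (j + 1) ∈ s(a i, a (i + 1)) := by rw [he]; exact Sym2.mem_mk_right _ _
        rcases Sym2.mem_iff.1 this with h | h
        · exact Finset.mem_image.2 ⟨i, by simp; omega, h.symm⟩
        · exact Finset.mem_image.2 ⟨i + 1, by simp; omega, h.symm⟩

/-- The edges of a walk form a connected graph, so it has at most one more vertex than edges. -/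
theorem card_vertices_le_card_edges_add_one {m : ℕ} [NeZero m] {V : Type*} [DecidableEq V]
    (u : Fin m → V) :
    (Finset.univ.image u).card ≤ (Finset.univ.image (walkEdge u)).card + 1 := by
  obtain ⟨m, rfl⟩ := Nat.exists_eq_succ_of_ne_zero (NeZero.ne m)
  have h := card_image_range_succ_le (fun i => u (Fin.ofNat (m + 1) i)) m
  refine le_trans (Finset.card_le_card ?_) (h.trans (Nat.succ_le_succ (Finset.card_le_card ?_)))
  · intro v hv
    obtain ⟨t, -, rfl⟩ := Finset.mem_image.1 hv
    refine Finset.mem_image.2 ⟨t, by simpa using t.2, ?_⟩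
    simp
  · intro e he
    obtain ⟨i, -, rfl⟩ := Finset.mem_image.1 he
    refine Finset.mem_image.2 ⟨Fin.ofNat (m + 1) i, Finset.mem_univ _, ?_⟩
    simp only [walkEdge]
    congr
    apply Fin.ext
    simp [Fin.add_def]

/-! ### Counting walks of a given shape -/

theorem card_image_eq_card_quotient_ker {ι α : Type*} [Fintype ι] [DecidableEq α] (f : ι → α) :
    (Finset.univ.image f).card = Nat.card (Quotient (Setoid.ker f)) := by
  rw [Nat.card_congr (Setoid.quotientKerEquivRange f), ← Set.ncard_coe_finset, Finset.coe_image,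
    Finset.coe_univ, Set.image_univ, Nat.card_coe_set_eq]

theorem walkEdge_eq_iff_of_ker_eq {m : ℕ} [NeZero m] {V W : Type*} {u : Fin m → V} {w : Fin m → W}
    (h : Setoid.ker u = Setoid.ker w) (t t' : Fin m) :
    walkEdge u t = walkEdge u t' ↔ walkEdge w t = walkEdge w t' := by
  have h' : ∀ i j, u i = u j ↔ w i = w j := fun i j => by
    rw [← Setoid.ker_def, h, Setoid.ker_def]
  simp [walkEdge, h']

theorem card_filter_ker_eq {ι α : Type*} [Fintype ι] [DecidableEq ι] [Fintype α]
    (s : Setoid ι) [DecidablePred fun u : ι → α => Setoid.ker u = s] :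
    (Finset.univ.filter fun u : ι → α => Setoid.ker u = s).card =
      (Fintype.card α).descFactorial (Nat.card (Quotient s)) := by
  classical
  let e : {u : ι → α // Setoid.ker u = s} ≃ (Quotient s ↪ α) :=
    { toFun := fun u =>
        ⟨Quotient.lift u.1 fun a b hab => by
            have : Setoid.ker u.1 a b := by rw [u.2]; exact hab
            exact this, by
          rintro ⟨a⟩ ⟨b⟩ hab
          refine Quotient.sound ?_
          have : Setoid.ker u.1 a b := hab
          rw [u.2] at this
          exact this⟩
      invFun := fun f => ⟨fun i => f (Quotient.mk s i), by
        ext a b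
        simp [Setoid.ker_def, Quotient.eq]⟩
      left_inv := fun u => rfl
      right_inv := fun f => by
        ext ⟨i⟩
        rfl }
  rw [← Fintype.card_subtype, Fintype.card_congr e, Fintype.card_embedding_eq,
    Nat.card_eq_fintype_card]

/-- Walks of a fixed shape: passing from `n` to `R` vertices. The factor `n` pays for the starting
vertex, and `n * q` for each further vertex, which comes with an edge of its own. -/
theorem descFactorial_mul_pow_le {n R m v e : ℕ} {q : ℝ} (hq0 : 0 ≤ q) (hq1 : q ≤ 1)
    (hR : n * q + m ≤ R) (hv : v ≤ m) (hv0 : 0 < v) (hve : v ≤ e + 1) :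
    (n.descFactorial v : ℝ) * q ^ e ≤ n * R.descFactorial v := by
  obtain ⟨v, rfl⟩ := Nat.exists_eq_succ_of_ne_zero hv0.ne'
  have hmR : m ≤ R := by
    have : (m : ℝ) ≤ R := le_trans (le_add_of_nonneg_left (by positivity)) hR
    exact_mod_cast this
  have h1 : (n.descFactorial (v + 1) : ℝ) ≤ n ^ (v + 1) := by
    exact_mod_cast Nat.descFactorial_le_pow n (v + 1)
  have h2 : q ^ e ≤ q ^ v := pow_le_pow_of_le_one hq0 hq1 (by omega)
  have hb : (n : ℝ) * q ≤ ((R + 1 - (v + 1) : ℕ) : ℝ) := by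
    rw [Nat.cast_sub (by omega)]
    push_cast
    have : ((v + 1 : ℕ) : ℝ) ≤ m := by exact_mod_cast hv
    push_cast at this
    linarith
  have hone : (1 : ℝ) ≤ ((R + 1 - (v + 1) : ℕ) : ℝ) := by
    have : 1 ≤ R + 1 - (v + 1) := by omega
    exact_mod_cast this
  have h3 : ((R + 1 - (v + 1) : ℕ) : ℝ) ^ (v + 1) ≤ R.descFactorial (v + 1) := by
    exact_mod_cast Nat.pow_sub_le_descFactorial R (v + 1)
  calc (n.descFactorial (v + 1) : ℝ) * q ^ e ≤ n ^ (v + 1) * q ^ v := by gcongr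
    _ = n * (n * q) ^ v := by ring
    _ ≤ n * ((R + 1 - (v + 1) : ℕ) : ℝ) ^ v := by gcongr
    _ ≤ n * ((R + 1 - (v + 1) : ℕ) : ℝ) ^ (v + 1) := by
        gcongr _ * ?_
        exact pow_le_pow_right₀ hone (Nat.le_succ v)
    _ ≤ _ := by gcongr

open Classical in
/-- Comparison of the weighted count of closed walks on `n` vertices with the plain count of closed
walks on `R` vertices, where `R` no longer depends on `n` but only on the mean degree `n * q`. -/
theorem sum_pow_card_edges_le {n R m : ℕ} [NeZero m] {q : ℝ} (hq0 : 0 ≤ q) (hq1 : q ≤ 1)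
    (hR : n * q + m ≤ R) :
    ∑ u : Fin m → Fin n with Repeats (walkEdge u), q ^ (Finset.univ.image (walkEdge u)).card ≤
      n * (Finset.univ.filter fun w : Fin m → Fin R => Repeats (walkEdge w)).card := by
  set G := Finset.univ.filter fun u : Fin m → Fin n => Repeats (walkEdge u)
  set H := Finset.univ.filter fun w : Fin m → Fin R => Repeats (walkEdge w)
  set T := G.image Setoid.ker
  rw [← Finset.sum_fiberwise_of_maps_to (s := G) (t := T) (g := Setoid.ker)
    (fun u hu => Finset.mem_image_of_mem _ hu)]
  have hfib : ∀ s ∈ T, ∑ u ∈ G with Setoid.ker u = s,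
      q ^ (Finset.univ.image (walkEdge u)).card ≤
        n * (H.filter fun w => Setoid.ker w = s).card := by
    intro s hs
    obtain ⟨u₀, hu₀, rfl⟩ := Finset.mem_image.1 hs
    have hu₀' : Repeats (walkEdge u₀) := (Finset.mem_filter.1 hu₀).2
    have hG : (G.filter fun u => Setoid.ker u = Setoid.ker u₀) ⊆
        Finset.univ.filter fun u : Fin m → Fin n => Setoid.ker u = Setoid.ker u₀ :=
      Finset.filter_subset_filter _ (Finset.subset_univ _)
    have hH : (H.filter fun w => Setoid.ker w = Setoid.ker u₀) =
        Finset.univ.filter fun w : Fin m → Fin R => Setoid.ker w = Setoid.ker u₀ := by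
      ext w
      simp only [H, Finset.mem_filter, Finset.mem_univ, true_and, and_iff_right_iff_imp]
      intro hw t
      obtain ⟨t', ht', he⟩ := hu₀' t
      exact ⟨t', ht', (walkEdge_eq_iff_of_ker_eq hw _ _).2 he⟩
    calc _ = ∑ u ∈ G with Setoid.ker u = Setoid.ker u₀,
            q ^ (Finset.univ.image (walkEdge u₀)).card := by
          refine Finset.sum_congr rfl fun u hu => ?_
          have hker : Setoid.ker (walkEdge u) = Setoid.ker (walkEdge u₀) :=
            Setoid.ext (walkEdge_eq_iff_of_ker_eq (Finset.mem_filter.1 hu).2)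
          rw [card_image_eq_card_quotient_ker, card_image_eq_card_quotient_ker, hker]
      _ ≤ ∑ u : Fin m → Fin n with Setoid.ker u = Setoid.ker u₀,
            q ^ (Finset.univ.image (walkEdge u₀)).card :=
          Finset.sum_le_sum_of_subset_of_nonneg hG fun _ _ _ => by positivity
      _ ≤ _ := by
          rw [Finset.sum_const, nsmul_eq_mul, hH, card_filter_ker_eq, card_filter_ker_eq,
            ← card_image_eq_card_quotient_ker, Fintype.card_fin, Fintype.card_fin]
          refine descFactorial_mul_pow_le hq0 hq1 hR ?_ ?_
            (card_vertices_le_card_edges_add_one u₀)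
          · exact Finset.card_image_le.trans (by simp)
          · exact Finset.card_pos.2 ⟨u₀ 0, by simp⟩
  refine (Finset.sum_le_sum hfib).trans ?_
  rw [← Finset.mul_sum]
  gcongr
  rw [← Nat.cast_sum]
  have h := Finset.sum_fiberwise_le_sum_of_sum_fiber_nonneg (s := H) (t := T) (g := Setoid.ker)
    (f := fun _ => 1) (fun _ _ => Nat.zero_le _)
  simp only [← Finset.card_eq_sum_ones] at h
  exact_mod_cast h

/-! ### The operator norm and traces -/

theorem toEuclideanCLM_pow {n : ℕ} (M : Matrix (Fin n) (Fin n) ℝ) (k : ℕ) :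
    Matrix.toEuclideanCLM (n := Fin n) (𝕜 := ℝ) (M ^ k) =
      Matrix.toEuclideanCLM (n := Fin n) (𝕜 := ℝ) M ^ k :=
  map_pow _ _ _

theorem opNorm_nonneg {n : ℕ} (M : Matrix (Fin n) (Fin n) ℝ) : 0 ≤ opNorm M :=
  norm_nonneg _

theorem opNorm_sq_le_sum_sq {n : ℕ} (M : Matrix (Fin n) (Fin n) ℝ) :
    opNorm M ^ 2 ≤ ∑ i, ∑ j, M i j ^ 2 := by
  have h0 : 0 ≤ ∑ i, ∑ j, M i j ^ 2 := by positivity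
  have h : opNorm M ≤ √(∑ i, ∑ j, M i j ^ 2) := by
    refine ContinuousLinearMap.opNorm_le_bound _ (Real.sqrt_nonneg _) fun x => ?_
    rw [← sq_le_sq₀ (norm_nonneg _) (by positivity), mul_pow, Real.sq_sqrt h0,
      EuclideanSpace.real_norm_sq_eq, EuclideanSpace.real_norm_sq_eq, Finset.sum_mul]
    refine Finset.sum_le_sum fun i _ => ?_
    exact Finset.sum_mul_sq_le_sq_mul_sq Finset.univ (fun l => M i l) (fun l => x l)
  calc opNorm M ^ 2 ≤ √(∑ i, ∑ j, M i j ^ 2) ^ 2 := by gcongr; exact opNorm_nonneg M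
    _ = _ := Real.sq_sqrt h0

/-- Restricted to powers of two, where the C⋆-identity alone gives `‖X ^ k‖ = ‖X‖ ^ k`. -/
theorem opNorm_pow_le_trace {n : ℕ} {X : Matrix (Fin n) (Fin n) ℝ} (hX : X.IsSymm) (j : ℕ) :
    opNorm X ^ (2 * 2 ^ j) ≤ (X ^ (2 * 2 ^ j)).trace := by
  have hsa : IsSelfAdjoint (Matrix.toEuclideanCLM (n := Fin n) (𝕜 := ℝ) X) := by
    have : IsSelfAdjoint X := by
      rw [IsSelfAdjoint, Matrix.star_eq_conjTranspose, Matrix.conjTranspose_eq_transpose_of_trivial,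
        hX.eq]
    exact this.map _
  have hpow : opNorm X ^ 2 ^ j = opNorm (X ^ 2 ^ j) := by
    unfold opNorm
    rw [toEuclideanCLM_pow, hsa.norm_pow_two_pow]
  have hsymm : (X ^ 2 ^ j).IsSymm := hX.pow _
  rw [mul_comm, pow_mul, hpow, pow_mul, pow_two (X ^ 2 ^ j)]
  refine (opNorm_sq_le_sum_sq _).trans (le_of_eq ?_)
  simp only [Matrix.trace, Matrix.diag, Matrix.mul_apply]
  refine Finset.sum_congr rfl fun i _ => Finset.sum_congr rfl fun l _ => ?_
  rw [hsymm.apply i l, pow_two]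

theorem trace_pow_le {n : ℕ} (Y : Matrix (Fin n) (Fin n) ℝ) {m : ℕ} (hm : 0 < m) :
    (Y ^ m).trace ≤ n * opNorm Y ^ m := by
  have hdiag : ∀ i, (Y ^ m) i i ≤ opNorm Y ^ m := by
    intro i
    have h1 : inner ℝ (EuclideanSpace.single i (1 : ℝ))
        (Matrix.toEuclideanCLM (n := Fin n) (𝕜 := ℝ) (Y ^ m) (EuclideanSpace.single i 1)) =
        (Y ^ m) i i := by
      rw [Matrix.inner_toEuclideanCLM]
      simp
    calc (Y ^ m) i i ≤ ‖EuclideanSpace.single i (1 : ℝ)‖ *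
          ‖Matrix.toEuclideanCLM (n := Fin n) (𝕜 := ℝ) (Y ^ m) (EuclideanSpace.single i 1)‖ := by
          rw [← h1]; exact real_inner_le_norm _ _
      _ ≤ ‖Matrix.toEuclideanCLM (n := Fin n) (𝕜 := ℝ) (Y ^ m)‖ := by
          have := (Matrix.toEuclideanCLM (n := Fin n) (𝕜 := ℝ) (Y ^ m)).le_opNorm
            (EuclideanSpace.single i (1 : ℝ))
          simpa using this
      _ ≤ opNorm Y ^ m := by
          rw [toEuclideanCLM_pow]
          exact norm_pow_le' _ hm
  calc (Y ^ m).trace ≤ ∑ _i : Fin n, opNorm Y ^ m := Finset.sum_le_sum fun i _ => hdiag i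
    _ = _ := by simp

/-! ### Discretization of the unit ball -/

theorem exists_half_net (R : ℕ) : ∃ N : Finset (EuclideanSpace ℝ (Fin R)),
    N.card ≤ 5 ^ R ∧ (∀ x ∈ N, ‖x‖ ≤ 1) ∧ ∀ z, ‖z‖ ≤ 1 → ∃ x ∈ N, ‖z - x‖ ≤ 1 / 2 := by
  classical
  let Sep (s : Finset (EuclideanSpace ℝ (Fin R))) : Prop :=
    (∀ c ∈ s, ‖c‖ ≤ 1) ∧ ∀ c ∈ s, ∀ d ∈ s, c ≠ d → 1 / 2 ≤ ‖c - d‖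
  have hbound : ∀ s, Sep s → s.card ≤ 5 ^ R := by
    intro s hs
    have hinj : Function.Injective fun x : EuclideanSpace ℝ (Fin R) => (2 : ℝ) • x :=
      smul_right_injective _ two_ne_zero
    have h := Besicovitch.card_le_of_separated (s.image fun x => (2 : ℝ) • x) ?_ ?_
    · rwa [Finset.card_image_of_injective _ hinj, finrank_euclideanSpace_fin] at h
    · intro c hc
      obtain ⟨x, hx, rfl⟩ := Finset.mem_image.1 hc
      have := hs.1 x hx
      rw [norm_smul, Real.norm_two]
      linarith
    · intro c hc d hd hcd
      obtain ⟨x, hx, rfl⟩ := Finset.mem_image.1 hc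
      obtain ⟨y, hy, rfl⟩ := Finset.mem_image.1 hd
      have := hs.2 x hx y hy (fun h => hcd (by rw [h]))
      rw [← smul_sub, norm_smul, Real.norm_two]
      linarith
  -- a separated set of maximal cardinality is a net
  let P : ℕ → Prop := fun c => ∃ s, Sep s ∧ s.card = c
  obtain ⟨N, hN, hcard⟩ : P (Nat.findGreatest P (5 ^ R)) :=
    Nat.findGreatest_spec (Nat.zero_le _) ⟨∅, by simp [Sep], rfl⟩
  refine ⟨N, hbound N hN, hN.1, fun z hz => ?_⟩
  by_contra! hfar
  have hzN : z ∉ N := fun h => by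
    have := hfar z h
    norm_num at this
  have hins : Sep (insert z N) := by
    refine ⟨?_, ?_⟩
    · intro c hc
      rcases Finset.mem_insert.1 hc with rfl | hc
      exacts [hz, hN.1 c hc]
    · intro c hc d hd hcd
      rcases Finset.mem_insert.1 hc with rfl | hc' <;> rcases Finset.mem_insert.1 hd with rfl | hd'
      · exact absurd rfl hcd
      · exact (hfar d hd').le
      · rw [norm_sub_rev]; exact (hfar c hc').le
      · exact hN.2 c hc' d hd' hcd
  have := Nat.le_findGreatest (P := P) (hbound _ hins) ⟨_, hins, rfl⟩
  rw [Finset.card_insert_of_notMem hzN] at this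
  omega

/-- The supremum of `⟨x, T y⟩` over a `1 / 2`-net controls `‖T‖`: passing to the net loses a factor `2`
in each of the two variables. -/
theorem norm_le_four_mul_of_net {E : Type*} [NormedAddCommGroup E] [InnerProductSpace ℝ E]
    {N : Finset E} (hN : ∀ z, ‖z‖ ≤ 1 → ∃ x ∈ N, ‖z - x‖ ≤ 1 / 2) (T : E →L[ℝ] E) {s : ℝ}
    (hs0 : 0 ≤ s) (hs : ∀ x ∈ N, ∀ y ∈ N, inner ℝ x (T y) ≤ s) : ‖T‖ ≤ 4 * s := by
  have hstep : ∀ y ∈ N, ‖T y‖ ≤ 2 * s := by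
    intro y hy
    rcases eq_or_ne (T y) 0 with h0 | h0
    · simp [h0, hs0]
    obtain ⟨x, hx, hzx⟩ := hN (‖T y‖⁻¹ • T y) (by
      rw [norm_smul, norm_inv, norm_norm, inv_mul_cancel₀ (norm_ne_zero_iff.2 h0)])
    have h1 : inner ℝ (‖T y‖⁻¹ • T y) (T y) = ‖T y‖ := by
      rw [real_inner_smul_left, real_inner_self_eq_norm_sq]
      field_simp
    have h2 : inner ℝ (‖T y‖⁻¹ • T y) (T y) =
        inner ℝ x (T y) + inner ℝ (‖T y‖⁻¹ • T y - x) (T y) := by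
      rw [← inner_add_left]
      congr 1
      abel
    have h3 := real_inner_le_norm (‖T y‖⁻¹ • T y - x) (T y)
    have h4 : ‖‖T y‖⁻¹ • T y - x‖ * ‖T y‖ ≤ 1 / 2 * ‖T y‖ := by gcongr
    linarith [hs x hx y hy]
  have hball : ∀ z, ‖z‖ ≤ 1 → ‖T z‖ ≤ 2 * s + ‖T‖ / 2 := by
    intro z hz
    obtain ⟨x, hx, hzx⟩ := hN z hz
    have h1 : T z = T x + T (z - x) := by rw [← map_add]; congr 1; abel
    have h2 := T.le_opNorm (z - x)
    have h3 : ‖T‖ * ‖z - x‖ ≤ ‖T‖ * (1 / 2) := by gcongr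
    calc ‖T z‖ ≤ ‖T x‖ + ‖T (z - x)‖ := by rw [h1]; exact norm_add_le _ _
      _ ≤ _ := by linarith [hstep x hx]
  have : ‖T‖ ≤ 2 * s + ‖T‖ / 2 := by
    refine T.opNorm_le_of_unit_norm (by positivity) fun z hz => hball z hz.le
  linarith

theorem opNorm_pow_le_sum_net {R : ℕ} {N : Finset (EuclideanSpace ℝ (Fin R))}
    (hN : ∀ z, ‖z‖ ≤ 1 → ∃ x ∈ N, ‖z - x‖ ≤ 1 / 2) (Y : Matrix (Fin R) (Fin R) ℝ) (k : ℕ) :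
    opNorm Y ^ (2 * k) ≤ ∑ x ∈ N, ∑ y ∈ N, 16 ^ k * (∑ i, ∑ j, x i * y j * Y i j) ^ (2 * k) := by
  have hinner : ∀ x y : EuclideanSpace ℝ (Fin R),
      inner ℝ x (Matrix.toEuclideanCLM (n := Fin R) (𝕜 := ℝ) Y y) =
        ∑ i, ∑ j, x i * y j * Y i j := by
    intro x y
    rw [Matrix.inner_toEuclideanCLM]
    simp only [dotProduct, Matrix.mulVec, Finset.mul_sum]
    exact Finset.sum_congr rfl fun i _ => Finset.sum_congr rfl fun j _ => by ring
  generalize hB : (fun x y : EuclideanSpace ℝ (Fin R) => ∑ i, ∑ j, x i * y j * Y i j) = B at *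
  replace hB : ∀ x y, ∑ i, ∑ j, x i * y j * Y i j = B x y := fun x y => congr_fun₂ hB x y
  simp only [hB] at hinner ⊢
  obtain ⟨x₀, hx₀, -⟩ := hN 0 (by simp)
  obtain ⟨⟨x, y⟩, hxy, hmax⟩ := Finset.exists_max_image (N ×ˢ N)
    (fun p => |B p.1 p.2|) ⟨(x₀, x₀), by simp [hx₀]⟩
  have hnorm : opNorm Y ≤ 4 * |B x y| := by
    refine norm_le_four_mul_of_net hN _ (abs_nonneg _) fun a ha b hb => ?_
    rw [hinner]
    exact (le_abs_self _).trans (hmax (a, b) (Finset.mem_product.2 ⟨ha, hb⟩))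
  rw [← Finset.sum_product' N N fun x y => (16 : ℝ) ^ k * B x y ^ (2 * k)]
  calc opNorm Y ^ (2 * k) ≤ (4 * |B x y|) ^ (2 * k) := by
        gcongr; exact opNorm_nonneg Y
    _ = 16 ^ k * B x y ^ (2 * k) := by
        rw [mul_pow, pow_mul |_|, sq_abs, ← pow_mul, pow_mul 4]; norm_num
    _ ≤ _ := Finset.single_le_sum (f := fun p => (16 : ℝ) ^ k * B p.1 p.2 ^ (2 * k))
        (fun p _ => by
          have := (even_two_mul k).pow_nonneg (B p.1 p.2)
          positivity) hxy

/-! ### Subgaussian moments -/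

theorem exp_le_add_exp_sq (y : ℝ) : Real.exp y ≤ y + Real.exp (y ^ 2) := by
  have h1 := Real.add_one_le_exp (y ^ 2)
  rcases le_or_gt |y| 1 with h | h
  · have h2 := (abs_le.1 (Real.abs_exp_sub_one_sub_id_le h)).2
    linarith
  · rcases lt_abs.1 h with hy | hy
    · have : Real.exp y ≤ Real.exp (y ^ 2) := Real.exp_le_exp.2 (by nlinarith)
      linarith
    · have : Real.exp y ≤ 1 := Real.exp_le_one_iff.2 (by linarith)
      nlinarith

/-- The values `2, -1, -1`, taken with equal weights. The law is centred, and, unlike a random sign,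
has all moments of order at least two, odd ones included, bounded below by one. -/
noncomputable def skewSign : Fin 3 → ℝ := ![2, -1, -1]

theorem sum_skewSign : ∑ b, skewSign b = 0 := by
  simp only [skewSign, Fin.sum_univ_three, Matrix.cons_val_zero, Matrix.cons_val_one,
    Matrix.cons_val]
  norm_num

theorem three_le_sum_skewSign_pow {l : ℕ} (hl : l ≠ 1) : 3 ≤ ∑ b, skewSign b ^ l := by
  simp only [skewSign, Fin.sum_univ_three, Matrix.cons_val_zero, Matrix.cons_val_one,
    Matrix.cons_val]
  rcases Nat.even_or_odd l with he | ho
  · have : (1 : ℝ) ≤ 2 ^ l := one_le_pow₀ one_le_two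
    rw [he.neg_one_pow]
    linarith
  · have h3 : 3 ≤ l := by
      obtain ⟨c, rfl⟩ := ho
      omega
    have : (2 : ℝ) ^ 3 ≤ 2 ^ l := pow_le_pow_right₀ one_le_two h3
    rw [ho.neg_one_pow]
    linarith

theorem sum_exp_mul_skewSign_le (x : ℝ) :
    ∑ b, Real.exp (x * skewSign b) ≤ 3 * Real.exp (4 * x ^ 2) := by
  have h1 := exp_le_add_exp_sq (x * 2)
  have h2 := exp_le_add_exp_sq (x * -1)
  have h3 : Real.exp ((x * -1) ^ 2) ≤ Real.exp (4 * x ^ 2) := Real.exp_le_exp.2 (by nlinarith)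
  have h4 : (x * 2) ^ 2 = 4 * x ^ 2 := by ring
  rw [h4] at h1
  simp only [skewSign, Fin.sum_univ_three, Matrix.cons_val_zero, Matrix.cons_val_one,
    Matrix.cons_val]
  linarith

theorem sum_exp_linear_skewSign_le {E : Type*} [Fintype E] [DecidableEq E] (c : E → ℝ) :
    ∑ ω : E → Fin 3, Real.exp (∑ e, c e * skewSign (ω e)) ≤
      3 ^ Fintype.card E * Real.exp (4 * ∑ e, c e ^ 2) := by
  simp_rw [Real.exp_sum]
  rw [← Fintype.prod_sum fun e b => Real.exp (c e * skewSign b)]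
  calc ∏ e, ∑ b, Real.exp (c e * skewSign b) ≤ ∏ e, 3 * Real.exp (4 * c e ^ 2) :=
        Finset.prod_le_prod (fun e _ => by positivity) fun e _ => sum_exp_mul_skewSign_le _
    _ = _ := by
        rw [Finset.prod_mul_distrib, Finset.prod_const, Finset.card_univ, Finset.mul_sum,
          Real.exp_sum]

theorem pow_even_le_factorial_mul_exp (x : ℝ) (k : ℕ) :
    x ^ (2 * k) ≤ (2 * k).factorial * (Real.exp x + Real.exp (-x)) := by
  have h := Real.pow_div_factorial_le_exp |x| (abs_nonneg x) (2 * k)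
  rw [div_le_iff₀ (by positivity), pow_mul, sq_abs, ← pow_mul, mul_comm (Real.exp _)] at h
  refine h.trans ?_
  gcongr
  rcases abs_cases x with ⟨h, -⟩ | ⟨h, -⟩ <;> rw [h]
  · linarith [Real.exp_pos (-x)]
  · linarith [Real.exp_pos x]

/-- Khinchine's inequality: the `2 * k`-th moment of a linear form in independent skewed signs is of
order `k ^ k`. It comes from the exponential moment at parameter `√k`. -/
theorem sum_linear_skewSign_pow_le {E : Type*} [Fintype E] [DecidableEq E] (c : E → ℝ)
    (hc : ∑ e, c e ^ 2 ≤ 2) {k : ℕ} (hk : 0 < k) :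
    ∑ ω : E → Fin 3, (∑ e, c e * skewSign (ω e)) ^ (2 * k) ≤
      3 ^ Fintype.card E * (2 * (4 * Real.exp 8 * k) ^ k) := by
  have hk' : (0 : ℝ) < k := by exact_mod_cast hk
  have hexp : ∀ a : ℝ, a ^ 2 = k →
      ∑ ω : E → Fin 3, Real.exp (a * ∑ e, c e * skewSign (ω e)) ≤
        3 ^ Fintype.card E * Real.exp (8 * k) := by
    intro a ha
    simp_rw [Finset.mul_sum, ← mul_assoc]
    refine (sum_exp_linear_skewSign_le fun e => a * c e).trans ?_
    have hsum : 4 * ∑ e, (a * c e) ^ 2 ≤ 8 * k := by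
      simp_rw [mul_pow, ha, ← Finset.mul_sum]
      nlinarith
    gcongr
  have hsq : √(k : ℝ) ^ 2 = k := Real.sq_sqrt hk'.le
  have h1 : (k : ℝ) ^ k * ∑ ω : E → Fin 3, (∑ e, c e * skewSign (ω e)) ^ (2 * k) ≤
      (2 * k).factorial * (2 * (3 ^ Fintype.card E * Real.exp (8 * k))) := by
    calc _ = ∑ ω : E → Fin 3, (√k * ∑ e, c e * skewSign (ω e)) ^ (2 * k) := by
          rw [Finset.mul_sum]
          refine Finset.sum_congr rfl fun ω _ => ?_
          rw [mul_pow, pow_mul √(k : ℝ), hsq]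
      _ ≤ ∑ ω : E → Fin 3, (2 * k).factorial * (Real.exp (√k * ∑ e, c e * skewSign (ω e)) +
            Real.exp (-√k * ∑ e, c e * skewSign (ω e))) :=
          Finset.sum_le_sum fun ω _ => by
            rw [neg_mul]
            exact pow_even_le_factorial_mul_exp _ _
      _ ≤ _ := by
          rw [← Finset.mul_sum, Finset.sum_add_distrib]
          gcongr
          linarith [hexp √k hsq, hexp (-√k) (by rw [neg_sq, hsq])]
  have h2 : ((2 * k).factorial : ℝ) ≤ (4 * k * k) ^ k := by
    have : (2 * k).factorial ≤ (2 * k) ^ (2 * k) := Nat.factorial_le_pow _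
    calc ((2 * k).factorial : ℝ) ≤ (2 * k) ^ (2 * k) := by exact_mod_cast this
      _ = _ := by rw [pow_mul]; ring
  have h3 : Real.exp (8 * k) = Real.exp 8 ^ k := by rw [← Real.exp_nat_mul]; ring_nf
  refine le_of_mul_le_mul_left (h1.trans ?_) (pow_pos hk' k)
  calc _ ≤ (4 * k * k : ℝ) ^ k * (2 * (3 ^ Fintype.card E * Real.exp (8 * k))) := by gcongr
    _ = _ := by rw [h3, mul_pow, mul_pow, mul_pow, mul_pow]; ring

/-! ### Products along a labelling -/

theorem prod_comp_eq_prod_pow {m : ℕ} {E B : Type*} [Fintype E] [DecidableEq E] (p : Fin m → E)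
    (f : E → B → ℝ) (x : E → B) :
    ∏ t, f (p t) (x (p t)) = ∏ e, f e (x e) ^ (Finset.univ.filter fun t => p t = e).card := by
  rw [← Finset.prod_fiberwise_of_maps_to (s := Finset.univ) (t := Finset.univ) (g := p)
    (fun _ _ => Finset.mem_univ _)]
  refine Finset.prod_congr rfl fun e _ => ?_
  rw [← Finset.prod_const]
  exact Finset.prod_congr rfl fun t ht => by rw [(Finset.mem_filter.1 ht).2]

theorem Repeats.card_ne_one {m : ℕ} {E : Type*} [DecidableEq E] {p : Fin m → E} (hp : Repeats p)
    (e : E) : (Finset.univ.filter fun t => p t = e).card ≠ 1 := by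
  intro h
  obtain ⟨t, ht⟩ := Finset.card_eq_one.1 h
  have hpt : p t = e := by
    have : t ∈ Finset.univ.filter fun t => p t = e := by rw [ht]; simp
    simpa using this
  obtain ⟨t', hne, hpt'⟩ := hp t
  have : t' ∈ ({t} : Finset (Fin m)) := by rw [← ht]; simp [hpt', hpt]
  exact hne (Finset.mem_singleton.1 this)

theorem exists_card_eq_one_of_not_repeats {m : ℕ} {E : Type*} [DecidableEq E] {p : Fin m → E}
    (hp : ¬ Repeats p) : ∃ e, (Finset.univ.filter fun t => p t = e).card = 1 := by
  simp only [Repeats, not_forall, not_exists, not_and] at hp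
  obtain ⟨t, ht⟩ := hp
  refine ⟨p t, Finset.card_eq_one.2 ⟨t, ?_⟩⟩
  ext t'
  simp only [Finset.mem_filter, Finset.mem_univ, true_and, Finset.mem_singleton]
  refine ⟨fun h => ?_, fun h => by rw [h]⟩
  by_contra hne
  exact ht t' hne h

/-! ### Counting closed walks on few vertices -/

open Classical in
/-- The left side is `3 ^ card E`, the number of outcomes `ω`, times the indicator of `Repeats p`: a
product of independent skewed signs along a labelling without unique values has expectation at least
one, and along any other labelling it has expectation zero. -/
theorem le_sum_prod_skewSign {m : ℕ} {E : Type*} [Fintype E] [DecidableEq E]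
    (p : Fin m → E) :
    (if Repeats p then (3 : ℝ) ^ Fintype.card E else 0) ≤
      ∑ ω : E → Fin 3, ∏ t, skewSign (ω (p t)) := by
  simp_rw [prod_comp_eq_prod_pow p (fun _ b => skewSign b)]
  rw [← Fintype.prod_sum fun e b => skewSign b ^ (Finset.univ.filter fun t => p t = e).card]
  split_ifs with hp
  · rw [← Finset.card_univ, ← Finset.prod_const]
    exact Finset.prod_le_prod (fun _ _ => by norm_num) fun e _ =>
      three_le_sum_skewSign_pow (hp.card_ne_one e)
  · obtain ⟨e, he⟩ := exists_card_eq_one_of_not_repeats hp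
    rw [Finset.prod_eq_zero (Finset.mem_univ e)]
    simpa [he] using sum_skewSign

/-- The symmetric `R × R` matrix with the skewed sign `ω e` at both positions of the unordered
pair `e`. -/
noncomputable def skewSignMatrix {R : ℕ} (ω : Sym2 (Fin R) → Fin 3) : Matrix (Fin R) (Fin R) ℝ :=
  Matrix.of fun i j => skewSign (ω s(i, j))

/-- In the form `∑ i j, x i * y j * Y i j` of a symmetric matrix `Y`, the coefficient of the entry at an
unordered pair collects at most two products `x i * y j`. -/
theorem sum_sq_fiber_sym2_le {R : ℕ} (x y : EuclideanSpace ℝ (Fin R)) (hx : ‖x‖ ≤ 1)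
    (hy : ‖y‖ ≤ 1) :
    ∑ e : Sym2 (Fin R), (∑ p : Fin R × Fin R with s(p.1, p.2) = e, x p.1 * y p.2) ^ 2 ≤ 2 := by
  have hcard : ∀ e : Sym2 (Fin R),
      (Finset.univ.filter fun p : Fin R × Fin R => s(p.1, p.2) = e).card ≤ 2 := by
    intro e
    induction e using Sym2.ind with
    | _ a b =>
      refine (Finset.card_le_card (t := {(a, b), (b, a)}) fun p hp => ?_).trans Finset.card_le_two
      have := (Finset.mem_filter.1 hp).2
      rw [Sym2.eq_iff] at this
      rcases this with ⟨h1, h2⟩ | ⟨h1, h2⟩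
      · simp [← h1, ← h2]
      · simp [← h1, ← h2]
  calc _ ≤ ∑ e : Sym2 (Fin R), 2 * ∑ p : Fin R × Fin R with s(p.1, p.2) = e,
          (x p.1 * y p.2) ^ 2 := by
        refine Finset.sum_le_sum fun e _ => sq_sum_le_card_mul_sum_sq.trans ?_
        gcongr
        exact_mod_cast hcard e
    _ = 2 * ∑ p : Fin R × Fin R, (x p.1 * y p.2) ^ 2 := by
        rw [← Finset.mul_sum, Finset.sum_fiberwise]
    _ = 2 * (‖x‖ ^ 2 * ‖y‖ ^ 2) := by
        rw [EuclideanSpace.real_norm_sq_eq, EuclideanSpace.real_norm_sq_eq, Finset.sum_mul_sum,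
          Fintype.sum_prod_type]
        simp_rw [mul_pow]
    _ ≤ 2 * (1 ^ 2 * 1 ^ 2) := by gcongr
    _ = 2 := by norm_num

theorem sum_skewSignMatrix_form_pow_le {R : ℕ} (x y : EuclideanSpace ℝ (Fin R)) (hx : ‖x‖ ≤ 1)
    (hy : ‖y‖ ≤ 1) {k : ℕ} (hk : 0 < k) :
    ∑ ω, (∑ i, ∑ j, x i * y j * skewSignMatrix ω i j) ^ (2 * k) ≤
      3 ^ Fintype.card (Sym2 (Fin R)) * (2 * (4 * Real.exp 8 * k) ^ k) := by
  refine le_trans (le_of_eq ?_)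
    (sum_linear_skewSign_pow_le _ (sum_sq_fiber_sym2_le x y hx hy) hk)
  refine Finset.sum_congr rfl fun ω _ => ?_
  congr 1
  rw [← Fintype.sum_prod_type' fun i j => x i * y j * skewSignMatrix ω i j,
    ← Finset.sum_fiberwise Finset.univ fun p : Fin R × Fin R => s(p.1, p.2)]
  refine Finset.sum_congr rfl fun e _ => ?_
  rw [Finset.sum_mul]
  refine Finset.sum_congr rfl fun p hp => ?_
  rw [← (Finset.mem_filter.1 hp).2]
  rfl

open Classical in
theorem card_repeats_walk_le_of_net {R k : ℕ} (hk : 0 < k) [NeZero (2 * k)] :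
    ((Finset.univ.filter fun w : Fin (2 * k) → Fin R => Repeats (walkEdge w)).card : ℝ) ≤
      R * (25 ^ R * (16 ^ k * (2 * (4 * Real.exp 8 * k) ^ k))) := by
  obtain ⟨N, hcard, hball, hnet⟩ := exists_half_net R
  set c : ℝ := 3 ^ Fintype.card (Sym2 (Fin R)) with hc
  have hc0 : 0 < c := by positivity
  have hlower : c * (Finset.univ.filter fun w : Fin (2 * k) → Fin R => Repeats (walkEdge w)).card ≤
      ∑ ω : Sym2 (Fin R) → Fin 3, (skewSignMatrix ω ^ (2 * k)).trace := by
    simp_rw [trace_pow_eq_sum_closed_walk]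
    rw [Finset.sum_comm, mul_comm, ← nsmul_eq_mul, ← Finset.sum_const, Finset.sum_filter]
    exact Finset.sum_le_sum fun w _ => le_sum_prod_skewSign (walkEdge w)
  have hupper : ∑ ω : Sym2 (Fin R) → Fin 3, (skewSignMatrix ω ^ (2 * k)).trace ≤
      R * (25 ^ R * (16 ^ k * (c * (2 * (4 * Real.exp 8 * k) ^ k)))) := by
    calc _ ≤ ∑ ω : Sym2 (Fin R) → Fin 3, R * ∑ x ∈ N, ∑ y ∈ N,
            16 ^ k * (∑ i, ∑ j, x i * y j * skewSignMatrix ω i j) ^ (2 * k) :=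
          Finset.sum_le_sum fun ω _ => (trace_pow_le _ (by omega)).trans <|
            mul_le_mul_of_nonneg_left (opNorm_pow_le_sum_net hnet _ k) (Nat.cast_nonneg _)
      _ = R * ∑ x ∈ N, ∑ y ∈ N, 16 ^ k *
            ∑ ω, (∑ i, ∑ j, x i * y j * skewSignMatrix ω i j) ^ (2 * k) := by
          rw [← Finset.mul_sum, Finset.sum_comm]
          congr 1
          refine Finset.sum_congr rfl fun x _ => ?_
          rw [Finset.sum_comm]
          exact Finset.sum_congr rfl fun y _ => (Finset.mul_sum _ _ _).symm
      _ ≤ R * ∑ x ∈ N, ∑ y ∈ N, 16 ^ k * (c * (2 * (4 * Real.exp 8 * k) ^ k)) := by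
          refine mul_le_mul_of_nonneg_left ?_ (Nat.cast_nonneg _)
          refine Finset.sum_le_sum fun x hx => Finset.sum_le_sum fun y hy => ?_
          exact mul_le_mul_of_nonneg_left
            (sum_skewSignMatrix_form_pow_le x y (hball x hx) (hball y hy) hk) (by positivity)
      _ = R * ((N.card : ℝ) * N.card * (16 ^ k * (c * (2 * (4 * Real.exp 8 * k) ^ k)))) := by
          simp only [Finset.sum_const, nsmul_eq_mul]
          ring
      _ ≤ _ := by
          have h5 : (N.card : ℝ) ≤ 5 ^ R := by exact_mod_cast hcard
          have h25 : (N.card : ℝ) * N.card ≤ 25 ^ R := by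
            calc (N.card : ℝ) * N.card ≤ 5 ^ R * 5 ^ R := by gcongr
              _ = _ := by rw [← mul_pow]; norm_num
          gcongr
  refine le_of_mul_le_mul_left ((hlower.trans hupper).trans (le_of_eq ?_)) hc0
  ring

/-- The growth rate of the number of closed walks of length `2 * k` on `3 * k` vertices. -/
noncomputable def walkRate : ℝ := 6 * 25 ^ 3 * 16 * (4 * Real.exp 8)

theorem walkRate_pos : 0 < walkRate := by
  unfold walkRate
  positivity

open Classical in
/-- There are at most `(walkRate * k) ^ k` closed walks of length `2 * k` on `3 * k` vertices that
use no edge only once. The net costs a factor `25 ^ (3 * k)`, which is harmless because the number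
of vertices is proportional to the length of the walk. -/
theorem card_repeats_walk_le {k : ℕ} (hk : 0 < k) [NeZero (2 * k)] :
    ((Finset.univ.filter fun w : Fin (2 * k) → Fin (3 * k) => Repeats (walkEdge w)).card : ℝ) ≤
      (walkRate * k) ^ k := by
  refine (card_repeats_walk_le_of_net hk).trans ?_
  have h6 : (6 * k : ℝ) ≤ 6 ^ k := by
    have h : ∀ k : ℕ, 0 < k → 6 * k ≤ 6 ^ k := by
      intro k hk
      induction k, hk using Nat.le_induction with
      | base => norm_num
      | succ k hk ih => rw [pow_succ]; omega
    exact_mod_cast h k hk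
  calc _ = (6 * k : ℝ) * ((25 ^ 3) ^ k * 16 ^ k * (4 * Real.exp 8 * k) ^ k) := by
        rw [pow_mul]; push_cast; ring
    _ ≤ 6 ^ k * ((25 ^ 3) ^ k * 16 ^ k * (4 * Real.exp 8 * k) ^ k) := by gcongr
    _ = _ := by
        rw [walkRate, ← mul_pow, ← mul_pow, ← mul_pow]
        ring

/-! ### Moments of the centred entries -/

theorem ProbMatrix.val_nonneg {n : ℕ} (P : ProbMatrix n) (i j : Fin n) : 0 ≤ P.val i j :=
  (P.prob i j).2.1

theorem ProbMatrix.val_le_one {n : ℕ} (P : ProbMatrix n) (i j : Fin n) : P.val i j ≤ 1 :=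
  (P.prob i j).2.2

theorem ProbMatrix.val_comm {n : ℕ} (P : ProbMatrix n) (i j : Fin n) : P.val i j = P.val j i := by
  rw [ProbMatrix.val, P.symm, ProbMatrix.val]

theorem meanAdjacency_comm {n : ℕ} (P S : ProbMatrix n) (i j : Fin n) :
    meanAdjacency P S i j = meanAdjacency P S j i := by
  simp only [meanAdjacency, Matrix.of_apply]
  rw [P.val_comm i j, S.val_comm i j]

/-- The deviation of the entry at the pair `e` from its mean, when its presence and sign
are `b`. -/
noncomputable def centredValue {n : ℕ} (P S : ProbMatrix n) (e : NodePair n) (b : Bool × Bool) : ℝ :=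
  signedValue b - meanAdjacency P S e.1.1 e.1.2

/-- The law of the presence and sign of the pair `e`. -/
noncomputable def pairLaw {n : ℕ} (P S : ProbMatrix n) (e : NodePair n) : Measure (Bool × Bool) :=
  (bernoulliMeasure true false (P.prob e.1.1 e.1.2)).prod
    (bernoulliMeasure true false (S.prob e.1.1 e.1.2))

instance {n : ℕ} (P S : ProbMatrix n) (e : NodePair n) : IsProbabilityMeasure (pairLaw P S e) := by
  unfold pairLaw
  infer_instance

theorem edgeSignMeasure_eq {n : ℕ} (P S : ProbMatrix n) :
    edgeSignMeasure P S = Measure.pi (pairLaw P S) := rfl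

instance {n : ℕ} (P S : ProbMatrix n) : IsProbabilityMeasure (edgeSignMeasure P S) := by
  rw [edgeSignMeasure_eq]
  infer_instance

theorem integral_pairLaw {n : ℕ} (P S : ProbMatrix n) (e : NodePair n) (f : Bool × Bool → ℝ) :
    ∫ b, f b ∂pairLaw P S e =
      P.val e.1.1 e.1.2 * (S.val e.1.1 e.1.2 * f (true, true) +
          (1 - S.val e.1.1 e.1.2) * f (true, false)) +
        (1 - P.val e.1.1 e.1.2) * (S.val e.1.1 e.1.2 * f (false, true) +
          (1 - S.val e.1.1 e.1.2) * f (false, false)) := by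
  rw [pairLaw, integral_prod _ Integrable.of_finite]
  simp [integral_bernoulliMeasure, ProbMatrix.val]

theorem integral_centredValue {n : ℕ} (P S : ProbMatrix n) (e : NodePair n) :
    ∫ b, centredValue P S e b ∂pairLaw P S e = 0 := by
  rw [integral_pairLaw]
  simp [centredValue, signedValue, meanAdjacency]
  ring

theorem integral_centredValue_sq_le {n : ℕ} (P S : ProbMatrix n) (e : NodePair n) :
    ∫ b, centredValue P S e b ^ 2 ∂pairLaw P S e ≤ P.val e.1.1 e.1.2 := by
  rw [integral_pairLaw]
  simp [centredValue, signedValue, meanAdjacency]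
  nlinarith [sq_nonneg (P.val e.1.1 e.1.2 * (1 - 2 * S.val e.1.1 e.1.2))]

/-- As `|1 - 2 s| > 2 c₀`, no cancellation of signs can hide a large edge probability in the mean. -/
theorem val_le_of_mean_degree_le {n : ℕ} (hn : 0 < n) {P S : ProbMatrix n} {c₀ α : ℝ}
    (hc₀ : 0 < c₀) {i j : Fin n} (hs : c₀ < |S.val i j - 1 / 2|)
    (hα : (n : ℝ) * |meanAdjacency P S i j| ≤ α) : P.val i j ≤ α / (2 * c₀ * n) := by
  have hn' : (0 : ℝ) < n := by exact_mod_cast hn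
  have hp := P.val_nonneg i j
  have h1 : |meanAdjacency P S i j| = P.val i j * (2 * |S.val i j - 1 / 2|) := by
    have : meanAdjacency P S i j = -(P.val i j * (2 * (S.val i j - 1 / 2))) := by
      simp only [meanAdjacency, Matrix.of_apply]
      ring
    rw [this, abs_neg, abs_mul, abs_mul, abs_of_nonneg hp, abs_two]
  rw [le_div_iff₀ (by positivity)]
  calc P.val i j * (2 * c₀ * n) = n * (P.val i j * (2 * c₀)) := by ring
    _ ≤ n * (P.val i j * (2 * |S.val i j - 1 / 2|)) := by gcongr
    _ ≤ α := by rwa [← h1]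

theorem abs_meanAdjacency_le_one {n : ℕ} (P S : ProbMatrix n) (i j : Fin n) :
    |meanAdjacency P S i j| ≤ 1 := by
  simp only [meanAdjacency, Matrix.of_apply]
  rw [abs_mul, abs_of_nonneg (P.val_nonneg i j)]
  refine mul_le_one₀ (P.val_le_one i j) (abs_nonneg _) (abs_le.2 ⟨?_, ?_⟩)
  · linarith [S.val_le_one i j]
  · linarith [S.val_nonneg i j]

theorem abs_centredValue_le_two {n : ℕ} (P S : ProbMatrix n) (e : NodePair n) (b : Bool × Bool) :
    |centredValue P S e b| ≤ 2 := by
  have h1 : |signedValue b| ≤ 1 := by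
    unfold signedValue
    split_ifs <;> simp
  have h2 := abs_meanAdjacency_le_one P S e.1.1 e.1.2
  have h3 := abs_sub (signedValue b) (meanAdjacency P S e.1.1 e.1.2)
  unfold centredValue
  linarith

theorem abs_integral_centredValue_pow_le {n : ℕ} (P S : ProbMatrix n) (e : NodePair n) {q : ℝ}
    (hq : P.val e.1.1 e.1.2 ≤ q) {l : ℕ} (hl : 2 ≤ l) :
    |∫ b, centredValue P S e b ^ l ∂pairLaw P S e| ≤ 2 ^ l * q := by
  calc |∫ b, centredValue P S e b ^ l ∂pairLaw P S e|
      ≤ ∫ b, |centredValue P S e b ^ l| ∂pairLaw P S e := abs_integral_le_integral_abs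
    _ ≤ ∫ b, 2 ^ l * centredValue P S e b ^ 2 ∂pairLaw P S e := by
        refine integral_mono Integrable.of_finite Integrable.of_finite fun b => ?_
        obtain ⟨l, rfl⟩ := Nat.exists_eq_add_of_le' hl
        simp only
        rw [abs_pow, pow_add, sq_abs]
        gcongr
        calc |centredValue P S e b| ^ l ≤ 2 ^ l := by
              gcongr; exact abs_centredValue_le_two P S e b
          _ ≤ 2 ^ (l + 2) := pow_le_pow_right₀ one_le_two (by omega)
    _ = 2 ^ l * ∫ b, centredValue P S e b ^ 2 ∂pairLaw P S e := integral_const_mul _ _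
    _ ≤ _ := by
        gcongr
        exact (integral_centredValue_sq_le P S e).trans hq

open Classical in
/-- Each distinct pair in the product costs a factor `q`, coming from the variance, and each single
factor costs the uniform bound `2`; a pair that occurs once makes the expectation vanish. -/
theorem abs_integral_prod_centredValue_le {n m : ℕ} (P S : ProbMatrix n) {q : ℝ}
    (hq : ∀ i j, P.val i j ≤ q) (p : Fin m → NodePair n) :
    |∫ x, ∏ t, centredValue P S (p t) (x (p t)) ∂edgeSignMeasure P S| ≤
      if Repeats p then 2 ^ m * q ^ (Finset.univ.image p).card else 0 := by
  simp_rw [prod_comp_eq_prod_pow p (centredValue P S)]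
  rw [edgeSignMeasure_eq, integral_fintype_prod_eq_prod (𝕜 := ℝ) (fun e b =>
    centredValue P S e b ^ (Finset.univ.filter fun t => p t = e).card), Finset.abs_prod]
  split_ifs with hp
  · have hle : ∀ e, |∫ b, centredValue P S e b ^ (Finset.univ.filter fun t => p t = e).card
        ∂pairLaw P S e| ≤ 2 ^ (Finset.univ.filter fun t => p t = e).card *
          (if e ∈ Finset.univ.image p then q else 1) := by
      intro e
      have h1 := hp.card_ne_one e
      split_ifs with he
      · refine abs_integral_centredValue_pow_le P S e (hq _ _) ?_
        obtain ⟨t, -, rfl⟩ := Finset.mem_image.1 he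
        have : 0 < (Finset.univ.filter fun t' => p t' = p t).card :=
          Finset.card_pos.2 ⟨t, by simp⟩
        omega
      · have h0 : (Finset.univ.filter fun t => p t = e).card = 0 := by
          rw [Finset.card_eq_zero, Finset.filter_eq_empty_iff]
          intro t _ ht
          exact he (ht ▸ Finset.mem_image_of_mem _ (Finset.mem_univ t))
        simp [h0]
    refine (Finset.prod_le_prod (fun _ _ => abs_nonneg _) fun e _ => hle e).trans (le_of_eq ?_)
    rw [Finset.prod_mul_distrib, ← prod_comp_eq_prod_pow p (fun _ _ => (2 : ℝ))
      (fun _ => ()), Finset.prod_ite_mem]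
    simp
  · obtain ⟨e, he⟩ := exists_card_eq_one_of_not_repeats hp
    refine (Finset.prod_eq_zero (Finset.mem_univ e) ?_).le
    rw [he]
    simp [integral_centredValue]

/-! ### Moments of the centred adjacency matrix -/

theorem signedAdjacency_comm {n : ℕ} (x : NodePair n → Bool × Bool) (i j : Fin n) :
    signedAdjacency x i j = signedAdjacency x j i := by
  simp only [signedAdjacency, Matrix.of_apply]
  rcases lt_trichotomy i j with h | rfl | h
  · simp [h, h.not_gt]
  · rfl
  · simp [h, h.not_gt]

theorem exists_nodePair_of_ne {n : ℕ} (P S : ProbMatrix n) {i j : Fin n} (hij : i ≠ j) :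
    ∃ e : NodePair n, s(e.1.1, e.1.2) = s(i, j) ∧
      ∀ x, (signedAdjacency x - meanAdjacency P S : Matrix (Fin n) (Fin n) ℝ) i j =
        centredValue P S e (x e) := by
  rcases lt_or_gt_of_ne hij with h | h
  · refine ⟨⟨(i, j), h⟩, rfl, fun x => ?_⟩
    simp [signedAdjacency, centredValue, h]
  · refine ⟨⟨(j, i), h⟩, Sym2.eq_swap, fun x => ?_⟩
    rw [Matrix.sub_apply, signedAdjacency_comm, meanAdjacency_comm]
    simp [signedAdjacency, centredValue, h]

theorem nodePair_sym2_injective {n : ℕ} :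
    Function.Injective fun e : NodePair n => s(e.1.1, e.1.2) := by
  rintro ⟨⟨a, b⟩, hab⟩ ⟨⟨c, d⟩, hcd⟩ h
  rcases Sym2.eq_iff.1 h with ⟨h1, h2⟩ | ⟨h1, h2⟩
  · simp only at h1 h2
    simp [h1, h2]
  · simp only at h1 h2 hab hcd
    rw [h1, h2] at hab
    exact absurd hab hcd.not_gt

open Classical in
theorem abs_integral_walk_prod_le {n m : ℕ} [NeZero m] (P S : ProbMatrix n) {q : ℝ} (hq0 : 0 ≤ q)
    (hq : ∀ i j, P.val i j ≤ q) (u : Fin m → Fin n) :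
    |∫ x, ∏ t, (signedAdjacency x - meanAdjacency P S) (u t) (u (t + 1)) ∂edgeSignMeasure P S| ≤
      if Repeats (walkEdge u) then 2 ^ m * q ^ (Finset.univ.image (walkEdge u)).card else 0 := by
  by_cases hloop : ∃ t, u t = u (t + 1)
  · obtain ⟨t, ht⟩ := hloop
    have hzero : ∀ x : NodePair n → Bool × Bool,
        ∏ t, (signedAdjacency x - meanAdjacency P S) (u t) (u (t + 1)) = 0 := fun x => by
      refine Finset.prod_eq_zero (Finset.mem_univ t) ?_
      rw [← ht]
      simp [signedAdjacency, meanAdjacency, ProbMatrix.val, P.diag]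
    simp only [hzero, integral_zero, abs_zero]
    split_ifs <;> positivity
  · push Not at hloop
    choose p hp hval using fun t => exists_nodePair_of_ne P S (hloop t)
    simp_rw [hval]
    have hiff : ∀ t t', p t = p t' ↔ walkEdge u t = walkEdge u t' := fun t t' => by
      rw [← nodePair_sym2_injective.eq_iff]
      simp only [hp]
      rfl
    have hker : Setoid.ker p = Setoid.ker (walkEdge u) := Setoid.ext hiff
    have hrep : Repeats p ↔ Repeats (walkEdge u) := by
      simp only [Repeats, hiff]
    have h := abs_integral_prod_centredValue_le P S hq p
    rwa [if_congr hrep rfl rfl, card_image_eq_card_quotient_ker, hker,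
      ← card_image_eq_card_quotient_ker] at h

theorem integral_trace_pow_le {n k : ℕ} (hk : 0 < k) (P S : ProbMatrix n) {q : ℝ} (hq0 : 0 ≤ q)
    (hq1 : q ≤ 1) (hq : ∀ i j, P.val i j ≤ q) (hnq : n * q ≤ k) :
    ∫ x, ((signedAdjacency x - meanAdjacency P S) ^ (2 * k)).trace ∂edgeSignMeasure P S ≤
      n * (4 * walkRate * k) ^ k := by
  classical
  have : NeZero (2 * k) := ⟨by omega⟩
  simp_rw [trace_pow_eq_sum_closed_walk]
  rw [integral_finsetSum _ fun _ _ => Integrable.of_finite]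
  calc _ ≤ ∑ u : Fin (2 * k) → Fin n, if Repeats (walkEdge u) then
          2 ^ (2 * k) * q ^ (Finset.univ.image (walkEdge u)).card else 0 :=
        Finset.sum_le_sum fun u _ =>
          (le_abs_self _).trans (abs_integral_walk_prod_le P S hq0 hq u)
    _ = 2 ^ (2 * k) * ∑ u : Fin (2 * k) → Fin n with Repeats (walkEdge u),
          q ^ (Finset.univ.image (walkEdge u)).card := by
        rw [← Finset.sum_filter, Finset.mul_sum]
    _ ≤ 2 ^ (2 * k) * (n * (walkRate * k) ^ k) := by
        gcongr
        refine (sum_pow_card_edges_le (R := 3 * k) hq0 hq1 ?_).trans ?_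
        · push_cast
          linarith
        · gcongr
          convert! card_repeats_walk_le hk
    _ = _ := by
        rw [pow_mul]
        norm_num only
        rw [mul_assoc 4, mul_pow 4]
        ring

/-- Markov's inequality for the `2 * k`-th moment, with `k` a power of two. -/
theorem tail_mul_pow_le {n : ℕ} (j : ℕ) (P S : ProbMatrix n) {q : ℝ} (hq0 : 0 ≤ q)
    (hq1 : q ≤ 1) (hq : ∀ i j, P.val i j ≤ q) (hnq : n * q ≤ (2 ^ j : ℕ)) {s : ℝ} (hs : 0 ≤ s) :
    s ^ (2 * 2 ^ j) *
        (edgeSignMeasure P S).real {x | s < opNorm (signedAdjacency x - meanAdjacency P S)} ≤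
      n * (4 * walkRate * (2 ^ j : ℕ)) ^ 2 ^ j := by
  have hsymm : ∀ x, (signedAdjacency x - meanAdjacency P S).IsSymm := fun x => by
    refine Matrix.IsSymm.ext fun i l => ?_
    rw [Matrix.sub_apply, Matrix.sub_apply, signedAdjacency_comm, meanAdjacency_comm]
  have hpow := fun x => opNorm_pow_le_trace (hsymm x) j
  refine le_trans ?_ (integral_trace_pow_le (by positivity) P S hq0 hq1 hq hnq)
  refine le_trans ?_ (mul_meas_ge_le_integral_of_nonneg
    (Filter.Eventually.of_forall fun x => (pow_nonneg (opNorm_nonneg _) _).trans (hpow x))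
    Integrable.of_finite (s ^ (2 * 2 ^ j)))
  refine mul_le_mul_of_nonneg_left (measureReal_mono fun x hx => ?_) (by positivity)
  exact (pow_le_pow_left₀ hs (le_of_lt hx) _).trans (hpow x)

/-! ### Transfer to a matrix with the given law -/

instance (n : ℕ) : MeasurableSingletonClass (Matrix (Fin n) (Fin n) ℝ) :=
  inferInstanceAs (MeasurableSingletonClass (Fin n → Fin n → ℝ))

/-- No measurability of `B` is needed, because the law is carried by a finite set. -/
theorem measure_preimage_le_of_hasLaw {n : ℕ} {P S : ProbMatrix n} {Ω : Type*} [MeasurableSpace Ω]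
    {μ : Measure Ω} {A : Ω → Matrix (Fin n) (Fin n) ℝ} (hA : HasLaw A (signedErdosRenyi P S) μ)
    (B : Set (Matrix (Fin n) (Fin n) ℝ)) :
    μ (A ⁻¹' B) ≤ edgeSignMeasure P S (signedAdjacency ⁻¹' B) := by
  set F : Set (Matrix (Fin n) (Fin n) ℝ) := Set.range signedAdjacency
  have hF : F.Finite := Set.finite_range _
  have hmeas : Measurable (signedAdjacency : (NodePair n → Bool × Bool) → _) :=
    measurable_of_finite _
  have hlaw : ∀ D : Set (Matrix (Fin n) (Fin n) ℝ), MeasurableSet D →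
      μ (A ⁻¹' D) = edgeSignMeasure P S (signedAdjacency ⁻¹' D) := fun D hD => by
    rw [← Measure.map_apply_of_aemeasurable hA.aemeasurable hD, hA.map_eq, signedErdosRenyi,
      Measure.map_apply hmeas hD]
  have hcompl : μ (A ⁻¹' Fᶜ) = 0 := by
    rw [hlaw _ hF.measurableSet.compl]
    have : signedAdjacency ⁻¹' Fᶜ = (∅ : Set (NodePair n → Bool × Bool)) := by
      ext x
      simp [F]
    rw [this, measure_empty]
  calc μ (A ⁻¹' B) ≤ μ (A ⁻¹' (B ∩ F) ∪ A ⁻¹' Fᶜ) := by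
        refine measure_mono fun ω hω => ?_
        by_cases h : A ω ∈ F
        exacts [Or.inl ⟨hω, h⟩, Or.inr h]
    _ ≤ μ (A ⁻¹' (B ∩ F)) + μ (A ⁻¹' Fᶜ) := measure_union_le _ _
    _ = edgeSignMeasure P S (signedAdjacency ⁻¹' (B ∩ F)) := by
        rw [hcompl, add_zero, hlaw _ (hF.subset Set.inter_subset_right).measurableSet]
    _ ≤ _ := measure_mono (Set.preimage_mono Set.inter_subset_left)

theorem one_sub_le_measureReal_of_tail {n : ℕ} {P S : ProbMatrix n} {Ω : Type*}
    [MeasurableSpace Ω] {μ : Measure Ω} [IsProbabilityMeasure μ]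
    {A : Ω → Matrix (Fin n) (Fin n) ℝ} (hA : HasLaw A (signedErdosRenyi P S) μ) {s δ : ℝ}
    (h : (edgeSignMeasure P S).real {x | s < opNorm (signedAdjacency x - meanAdjacency P S)} ≤ δ) :
    1 - δ ≤ μ.real {ω | opNorm (A ω - meanAdjacency P S) ≤ s} := by
  have h1 := measure_preimage_le_of_hasLaw hA {M | s < opNorm (M - meanAdjacency P S)}
  have h2 : μ.real {ω | s < opNorm (A ω - meanAdjacency P S)} ≤ δ :=
    (ENNReal.toReal_mono (measure_ne_top _ _) h1).trans h
  have h3 : (1 : ℝ) ≤ μ.real {ω | opNorm (A ω - meanAdjacency P S) ≤ s} +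
      μ.real {ω | s < opNorm (A ω - meanAdjacency P S)} := by
    rw [← probReal_univ (μ := μ)]
    refine le_trans (measureReal_mono ?_) (measureReal_union_le _ _)
    exact fun ω _ => le_or_gt (opNorm (A ω - meanAdjacency P S)) s
  linarith

theorem theorem3p1 (r c₀ c₁ : ℝ) (hr : 0 < r) (hc₀ : 0 < c₀) (hc₁ : 0 < c₁) :
    ∃ C : ℝ, 0 < C ∧ ∃ N : ℕ, ∀ n : ℕ, N ≤ n →
      ∀ (P S : ProbMatrix n) (α : ℝ),
        (∀ i j : Fin n, c₀ < |S.val i j - 1 / 2|) →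
        (∀ i j : Fin n, (n : ℝ) * |meanAdjacency P S i j| ≤ α) →
        c₁ * Real.log n ≤ α →
        ∀ (Ω : Type*) [MeasurableSpace Ω] (μ : Measure Ω) [IsProbabilityMeasure μ]
          (A : Ω → Matrix (Fin n) (Fin n) ℝ),
          HasLaw A (signedErdosRenyi P S) μ →
          1 - (n : ℝ) ^ (-r) ≤
            μ.real {ω | opNorm (A ω - meanAdjacency P S) ≤ C * Real.sqrt α} := by
  -- `K * α` dominates both the mean degree `n * q` and `(r + 1) * log n`
  set K : ℝ := 1 / (2 * c₀) + (r + 1) / c₁ with hK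
  have hKpos : 0 < K := by positivity
  have hw := walkRate_pos
  -- with `k ≤ 2 * K * α`, this constant gives `(C * √α) ^ (2 * k) ≥ exp k * (4 * walkRate * k) ^ k`;
  -- `3 ≤ n` ensures `1 ≤ log n`
  refine ⟨√(8 * walkRate * K * Real.exp 1), by positivity, 3, ?_⟩
  intro n hn P S α hs hα hlog Ω _ μ _ A hA
  have hn0 : (0 : ℝ) < n := by
    have : 0 < n := by omega
    exact_mod_cast this
  have hlog1 : 1 ≤ Real.log n := by
    rw [Real.le_log_iff_exp_le hn0]
    have : (3 : ℝ) ≤ n := by exact_mod_cast hn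
    linarith [Real.exp_one_lt_d9]
  have hα0 : 0 < α := lt_of_lt_of_le (by positivity) hlog
  have hKlog : (r + 1) * Real.log n ≤ K * α := by
    calc (r + 1) * Real.log n = (r + 1) / c₁ * (c₁ * Real.log n) := by field_simp
      _ ≤ (r + 1) / c₁ * α := by gcongr
      _ ≤ K * α := by
        gcongr
        rw [hK]
        exact le_add_of_nonneg_left (by positivity)
  obtain ⟨j, hj, hj'⟩ := exists_nat_pow_near (x := K * α) (by nlinarith) one_lt_two
  set k : ℕ := 2 ^ (j + 1) with hk
  have hkcast : (k : ℝ) = 2 ^ (j + 1) := by rw [hk]; push_cast; rfl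
  have hk1 : K * α ≤ k := by rw [hkcast]; exact hj'.le
  have hk2 : (k : ℝ) ≤ 2 * (K * α) := by rw [hkcast, pow_succ]; linarith
  have hnq : n * min 1 (α / (2 * c₀ * n)) ≤ (k : ℝ) := by
    calc n * min 1 (α / (2 * c₀ * n)) ≤ n * (α / (2 * c₀ * n)) := by
          gcongr; exact min_le_right _ _
      _ = 1 / (2 * c₀) * α := by field_simp
      _ ≤ K * α := by
        gcongr
        rw [hK]
        exact le_add_of_nonneg_right (by positivity)
      _ ≤ k := hk1
  have htail := tail_mul_pow_le (j + 1) P S (q := min 1 (α / (2 * c₀ * n))) (by positivity)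
    (min_le_left _ _) (fun i l => le_min (P.val_le_one i l)
      (val_le_of_mean_degree_le (by omega) hc₀ (hs i l) (hα i l))) hnq
    (s := √(8 * walkRate * K * Real.exp 1) * √α) (by positivity)
  rw [← hk] at htail
  refine one_sub_le_measureReal_of_tail hA ?_
  set τ := (edgeSignMeasure P S).real {x | √(8 * walkRate * K * Real.exp 1) * √α <
    opNorm (signedAdjacency x - meanAdjacency P S)}
  have hsq : (√(8 * walkRate * K * Real.exp 1) * √α) ^ (2 * k) =
      (8 * walkRate * K * α) ^ k * Real.exp k := by
    rw [pow_mul, mul_pow, Real.sq_sqrt (by positivity), Real.sq_sqrt hα0.le,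
      ← mul_one (k : ℝ), Real.exp_nat_mul, ← mul_pow]
    ring
  have hτ : Real.exp k * τ ≤ n := by
    have hpos : 0 < (8 * walkRate * K * α) ^ k := by positivity
    refine le_of_mul_le_mul_left ?_ hpos
    rw [hsq] at htail
    calc _ = (8 * walkRate * K * α) ^ k * Real.exp k * τ := by ring
      _ ≤ _ := htail
      _ ≤ n * (8 * walkRate * K * α) ^ k := by
        gcongr n * ?_ ^ k
        nlinarith
      _ = _ := mul_comm _ _
  have hexp : (n : ℝ) * (n : ℝ) ^ r ≤ Real.exp k := by
    rw [Real.rpow_def_of_pos hn0]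
    nth_rewrite 1 [← Real.exp_log hn0]
    rw [← Real.exp_add]
    refine Real.exp_le_exp.2 ?_
    linarith
  have hnr : 0 < (n : ℝ) ^ r := Real.rpow_pos_of_pos hn0 r
  rw [Real.rpow_neg hn0.le, ← one_div, le_div_iff₀ hnr]
  have hτ0 : 0 ≤ τ := measureReal_nonneg
  refine le_of_mul_le_mul_left ?_ hn0
  calc n * (τ * (n : ℝ) ^ r) = n * (n : ℝ) ^ r * τ := by ring
    _ ≤ Real.exp k * τ := by gcongr
    _ ≤ n * 1 := by rwa [mul_one]
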